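/- For a topological space $X$ let $C(X)$ be the vector space of all continuous functions $X\to\mathbb R$ and $C^*(X)$ its subspace of bounded functions; write $C_p(X)$ and $C_p^*(X)$ for these spaces with the topology of pointwise convergence and $\|f\|=\sup_{x\in X}|f(x)|$ for $f\in C^*(X)$. Let $D(X)$ denote one of $C(X)$, $C^*(X)$ and $D(Y)$ one of $C(Y)$, $C^*(Y)$, and write $D_p(X)$, $D_p(Y)$ for these spaces with the topology of pointwise convergence. A map $T:D_p(X)\to D_p(Y)$, not assumed linear, is uniformly continuous if for every neighborhood $U$ of the zero function in $D_p(Y)$ there is a neighborhood $V$ of the zero function in $D_p(X)$ such that $f,g\in D_p(X)$ and $f-g\in V$ imply $T(f)-T(g)\in U$. It is inversely bounded if for every sequence $(g_n)$ in $C^*(Y)$ with $\sup_n\|g_n\|<\infty$ there is a sequence $(f_n)$ in $C^*(X)$ with $\sup_n\|f_n\|<\infty$ and $T(f_n)=g_n$ for all $n$. A space $Z$ is scattered if every nonempty subset $A\subseteq Z$ has a point that is isolated in $A$, and strongly $\sigma$-scattered if $Z$ is the union of countably many closed subspaces each of which is scattered. **Theorem.** Let $X$ and $Y$ be metrizable spaces,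 and let $T:D_p(X)\to D_p(Y)$ be an inversely bounded, uniformly continuous surjection. If $X$ is strongly $\sigma$-scattered, then $Y$ is strongly $\sigma$-scattered. -/

import Mathlib

open Topology

/-- The two kinds of function spaces: all continuous functions, `C(X)`, or the bounded
continuous ones, `C^*(X)`. -/
inductive FunKind where
  | all
  | bounded

/-- `DSpace k X` is `C_p(X)` for `k = FunKind.all` and `C_p^*(X)` for `k = FunKind.bounded`.
As a subspace of the product `X → ℝ` it carries the topology (and the uniform structure) of
pointwise convergence. -/
def DSpace (k : FunKind) (X : Type*) [TopologicalSpace X] : Submodule ℝ (X → ℝ) where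
  carrier := {f | Continuous f ∧ (k = FunKind.bounded → ∃ M : ℝ, ∀ x, |f x| ≤ M)}
  zero_mem' := ⟨continuous_const, fun _ => ⟨0, fun x => by simp⟩⟩
  add_mem' := by
    rintro f g ⟨hf, hf'⟩ ⟨hg, hg'⟩
    refine ⟨hf.add hg, fun hk => ?_⟩
    obtain ⟨M, hM⟩ := hf' hk
    obtain ⟨N, hN⟩ := hg' hk
    exact ⟨M + N, fun x => (abs_add_le _ _).trans (add_le_add (hM x) (hN x))⟩
  smul_mem' := by
    rintro c f ⟨hf, hf'⟩
    refine ⟨hf.const_smul c, fun hk => ?_⟩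
    obtain ⟨M, hM⟩ := hf' hk
    refine ⟨|c| * M, fun x => ?_⟩
    simpa [abs_mul] using mul_le_mul_of_nonneg_left (hM x) (abs_nonneg c)

/-- A sequence of functions whose supremum norms are bounded by a common constant
(in particular each member is a bounded function). -/
def NormBoundedSeq {X : Type*} (f : ℕ → X → ℝ) : Prop :=
  ∃ M : ℝ, 0 < M ∧ ∀ n x, |f n x| ≤ M

/-- `T : D(X) → D(Y)` is inversely bounded: every norm bounded sequence `(g n)` in `C^*(Y)`
has the form `(T (f n))` for some norm bounded sequence `(f n)` in `C^*(X)`. -/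
def InverselyBounded {k l : FunKind} {X Y : Type*} [TopologicalSpace X] [TopologicalSpace Y]
    (T : DSpace k X → DSpace l Y) : Prop :=
  ∀ g : ℕ → DSpace l Y, NormBoundedSeq (fun n => (g n : Y → ℝ)) →
    ∃ f : ℕ → DSpace k X, NormBoundedSeq (fun n => (f n : X → ℝ)) ∧ ∀ n, T (f n) = g n

/-- The subspace `S` of `X` is scattered: every nonempty `A ⊆ S` has a point that is isolated
in `A`. -/
def IsScatteredSet {X : Type*} [TopologicalSpace X] (S : Set X) : Prop :=
  ∀ A : Set X, A ⊆ S → A.Nonempty → ∃ a ∈ A, ∃ U : Set X, IsOpen U ∧ U ∩ A = {a}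

/-- `X` is a countable union of closed scattered subspaces. -/
def StronglySigmaScattered (X : Type*) [TopologicalSpace X] : Prop :=
  ∃ F : ℕ → Set X, (∀ n, IsClosed (F n) ∧ IsScatteredSet (F n)) ∧ ⋃ n, F n = Set.univ

/-! In a metrizable space, a countable union of scattered subspaces is a countable union of closed
discrete sets (`exists_closedDiscrete_cover`); let `E n` be such sets for `X`. Uniform continuity
gives each `y` a finite set `K y` that coarsely controls `T f` at `y`; take it of least cardinality
over all constants. By minimality, every controlling set with the same constant at a nearby point
comes close to each point of `K y` (`DeterminedBy.eventually_inter_nonempty`). Split `Y` into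
countably many pieces by the constant, the cardinality and a bound on the indices of the `E i` used.
Within a piece, closeness becomes equality, so `K` is locally constant; since a finite set controls
only finitely many points (`InverselyBounded.finite_setOf_determinedBy`), each piece is discrete. -/

/-! ### Scattered and closed discrete sets -/

/-- A set without accumulation points, i.e. a closed discrete subspace. -/
def IsClosedDiscrete {X : Type*} [TopologicalSpace X] (E : Set X) : Prop :=
  ∀ x, ∀ᶠ z in 𝓝[≠] x, z ∉ E

theorem IsClosedDiscrete.isClosed {X : Type*} [TopologicalSpace X] {E : Set X}
    (hE : IsClosedDiscrete E) : IsClosed E := by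
  rw [← isOpen_compl_iff, isOpen_iff_mem_nhds]
  intro x hx
  filter_upwards [eventually_nhdsWithin_iff.1 (hE x)] with z hz
  by_cases h : z = x
  · exact h ▸ hx
  · exact hz h

/-- A subspace all of whose points are isolated in it is scattered. -/
theorem isScatteredSet_of_eventually {X : Type*} [TopologicalSpace X] {S : Set X}
    (hS : ∀ x ∈ S, ∀ᶠ z in 𝓝[≠] x, z ∉ S) : IsScatteredSet S := by
  rintro A hA ⟨a, ha⟩
  obtain ⟨U, hU, hUo, haU⟩ :=
    eventually_nhds_iff.1 (eventually_nhdsWithin_iff.1 (hS a (hA ha)))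
  refine ⟨a, ha, U, hUo, Set.Subset.antisymm ?_ ?_⟩
  · rintro z ⟨hzU, hzA⟩
    by_contra hne
    exact hU z hzU hne (hA hzA)
  · rintro z rfl
    exact ⟨haU, ha⟩

theorem isClosedDiscrete_of_separated {X : Type*} [MetricSpace X] {E : Set X} {r : ℝ}
    (hr : 0 < r) (hE : ∀ x ∈ E, ∀ y ∈ E, x ≠ y → r ≤ dist x y) : IsClosedDiscrete E := by
  intro x
  by_cases h : ∃ z ∈ E, z ≠ x ∧ dist z x < r / 2
  · obtain ⟨z, hz, hzx, hd⟩ := h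
    have h1 : ∀ᶠ w in 𝓝[≠] x, w ≠ z :=
      (eventually_ne_nhds hzx.symm).filter_mono nhdsWithin_le_nhds
    have h2 : ∀ᶠ w in 𝓝[≠] x, dist w x < r / 2 :=
      nhdsWithin_le_nhds (Metric.ball_mem_nhds x (half_pos hr))
    filter_upwards [h1, h2] with w hwz hw hwE
    have := hE w hwE z hz hwz
    have := dist_triangle_right w z x
    linarith
  · push Not at h
    have h2 : ∀ᶠ w in 𝓝[≠] x, dist w x < r / 2 :=
      nhdsWithin_le_nhds (Metric.ball_mem_nhds x (half_pos hr))
    filter_upwards [h2, self_mem_nhdsWithin] with w hw hwx hwE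
    exact absurd hw (not_lt.2 (h w hwE hwx))

/-- The points of a scattered subspace of a metric space can be given radii `1 / (n + 1)` in
such a way that of two distinct points one lies outside the ball around the other. -/
theorem IsScatteredSet.exists_radii {X : Type*} [MetricSpace X] {S : Set X}
    (hS : IsScatteredSet S) :
    ∃ R : Set (X × ℕ), (∀ x ∈ S, ∃ n, (x, n) ∈ R) ∧
      ∀ a ∈ R, ∀ b ∈ R, a.1 ≠ b.1 →
        1 / ((a.2 : ℝ) + 1) ≤ dist a.1 b.1 ∨ 1 / ((b.2 : ℝ) + 1) ≤ dist a.1 b.1 := by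
  -- The second clause makes the balls around chosen points contain only chosen points of `S`, so a
  -- point added later lies outside all earlier balls.
  let P : Set (Set (X × ℕ)) := {R |
    (∀ a ∈ R, ∀ b ∈ R, a.1 ≠ b.1 →
        1 / ((a.2 : ℝ) + 1) ≤ dist a.1 b.1 ∨ 1 / ((b.2 : ℝ) + 1) ≤ dist a.1 b.1) ∧
    ∀ a ∈ R, ∀ y ∈ S, dist a.1 y < 1 / ((a.2 : ℝ) + 1) → ∃ m, (y, m) ∈ R}
  obtain ⟨R, hR⟩ : ∃ R, Maximal (· ∈ P) R := by
    refine zorn_subset P fun c hc hchain => ⟨⋃₀ c, ⟨?_, ?_⟩, fun s hs => Set.subset_sUnion_of_mem hs⟩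
    · rintro a ⟨s, hs, has⟩ b ⟨t, ht, hbt⟩ hab
      rcases hchain.total hs ht with h | h
      · exact (hc ht).1 a (h has) b hbt hab
      · exact (hc hs).1 a has b (h hbt) hab
    · rintro a ⟨s, hs, has⟩ y hy hd
      obtain ⟨m, hm⟩ := (hc hs).2 a has y hy hd
      exact ⟨m, s, hs, hm⟩
  refine ⟨R, ?_, hR.prop.1⟩
  by_contra hne
  push Not at hne
  obtain ⟨x, hxS, hx⟩ := hne
  obtain ⟨a, ⟨haS, haR⟩, U, hUo, hU⟩ :=
    hS {x | x ∈ S ∧ ∀ n, (x, n) ∉ R} (fun _ h => h.1) ⟨x, hxS, hx⟩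
  have haU : a ∈ U := (hU.symm.subset (Set.mem_singleton a)).1
  obtain ⟨ε, hε, hball⟩ := Metric.isOpen_iff.1 hUo a haU
  obtain ⟨n, hn⟩ := exists_nat_one_div_lt hε
  have hnear : ∀ y ∈ S, dist a y < 1 / ((n : ℝ) + 1) → y = a ∨ ∃ m, (y, m) ∈ R := by
    intro y hy hd
    by_contra hcon
    push Not at hcon
    have hyU : y ∈ U := hball (by rw [Metric.mem_ball, dist_comm]; exact hd.trans hn)
    exact hcon.1 (hU.subset ⟨hyU, hy, hcon.2⟩)
  have hfar : ∀ b ∈ R, 1 / ((b.2 : ℝ) + 1) ≤ dist b.1 a := by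
    intro b hb
    by_contra hlt
    obtain ⟨m, hm⟩ := hR.prop.2 b hb a haS (not_le.1 hlt)
    exact haR m hm
  have hins : insert (a, n) R ∈ P := by
    refine ⟨?_, ?_⟩
    · rintro b (rfl | hb) c (rfl | hc) hbc
      · exact absurd rfl hbc
      · exact Or.inr (by rw [dist_comm]; exact hfar c hc)
      · exact Or.inl (hfar b hb)
      · exact hR.prop.1 b hb c hc hbc
    · rintro b (rfl | hb) y hy hd
      · rcases hnear y hy hd with rfl | ⟨m, hm⟩
        · exact ⟨n, Or.inl rfl⟩
        · exact ⟨m, Or.inr hm⟩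
      · obtain ⟨m, hm⟩ := hR.prop.2 b hb y hy hd
        exact ⟨m, Or.inr hm⟩
  exact haR n (hR.le_of_ge hins (Set.subset_insert _ _) (Set.mem_insert _ _))

theorem IsScatteredSet.exists_closedDiscrete_cover {X : Type*} [TopologicalSpace X]
    [TopologicalSpace.MetrizableSpace X] {S : Set X} (hS : IsScatteredSet S) :
    ∃ E : ℕ → Set X, (∀ n, IsClosedDiscrete (E n)) ∧ S ⊆ ⋃ n, E n := by
  let := TopologicalSpace.metrizableSpaceMetric X
  obtain ⟨R, hRS, hR⟩ := hS.exists_radii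
  refine ⟨fun n => {x | (x, n) ∈ R}, fun n => ?_, fun x hx => Set.mem_iUnion.2 (hRS x hx)⟩
  refine isClosedDiscrete_of_separated (r := 1 / ((n : ℝ) + 1)) (by positivity) ?_
  intro x hx y hy hxy
  exact (hR (x, n) hx (y, n) hy hxy).elim id id

/-- A metrizable space that is a countable union of scattered subspaces is a countable union of
closed discrete subspaces. -/
theorem exists_closedDiscrete_cover {X ι : Type*} [TopologicalSpace X]
    [TopologicalSpace.MetrizableSpace X] [Countable ι] [Nonempty ι] (F : ι → Set X)
    (hF : ∀ i, IsScatteredSet (F i)) (hcov : ∀ x, ∃ i, x ∈ F i) :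
    ∃ E : ℕ → Set X, (∀ n, IsClosedDiscrete (E n)) ∧ ∀ x, ∃ n, x ∈ E n := by
  choose E hE hEF using fun i => (hF i).exists_closedDiscrete_cover
  obtain ⟨e, he⟩ := exists_surjective_nat (ι × ℕ)
  refine ⟨fun n => E (e n).1 (e n).2, fun n => hE _ _, fun x => ?_⟩
  obtain ⟨i, hi⟩ := hcov x
  obtain ⟨m, hm⟩ := Set.mem_iUnion.1 (hEF i hi)
  obtain ⟨n, hn⟩ := he (i, m)
  exact ⟨n, by simpa only [hn] using hm⟩

/-- The pieces need not be closed: refining them to closed discrete sets restores closedness. -/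
theorem stronglySigmaScattered_of_scattered_cover {X ι : Type*} [TopologicalSpace X]
    [TopologicalSpace.MetrizableSpace X] [Countable ι] [Nonempty ι] (F : ι → Set X)
    (hF : ∀ i, IsScatteredSet (F i)) (hcov : ∀ x, ∃ i, x ∈ F i) :
    StronglySigmaScattered X := by
  obtain ⟨E, hE, hcovE⟩ := exists_closedDiscrete_cover F hF hcov
  exact ⟨E, fun n => ⟨(hE n).isClosed, isScatteredSet_of_eventually fun x _ => hE n x⟩,
    Set.iUnion_eq_univ_iff.2 hcovE⟩

/-! ### Finite sets controlling a point -/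

/-- The value of `T f` at `y` is coarsely controlled by the restriction of `f` to the finite
set `K`, with constants `1 / (p + 1)` and `p`. -/
def DeterminedBy {k l : FunKind} {X Y : Type*} [TopologicalSpace X] [TopologicalSpace Y]
    (T : DSpace k X → DSpace l Y) (p : ℕ) (y : Y) (K : Finset X) : Prop :=
  ∀ f g : DSpace k X, (∀ x ∈ K, |(f : X → ℝ) x - (g : X → ℝ) x| < 1 / ((p : ℝ) + 1)) →
    |(T f : Y → ℝ) y - (T g : Y → ℝ) y| ≤ p

section

variable {k l : FunKind} {X Y : Type*} [TopologicalSpace X] [TopologicalSpace Y]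
  {T : DSpace k X → DSpace l Y}

theorem UniformContinuous.exists_determinedBy (hT : UniformContinuous T) (y : Y) :
    ∃ (K : Finset X) (p : ℕ), DeterminedBy T p y K := by
  have heval : UniformContinuous fun f : DSpace k X => (T f : Y → ℝ) y :=
    (Pi.uniformContinuous_proj (fun _ : Y => ℝ) y).comp (uniformContinuous_subtype_val.comp hT)
  have hmem := heval (Metric.dist_mem_uniformity one_pos)
  rw [Filter.mem_map, uniformity_subtype, Filter.mem_comap] at hmem
  obtain ⟨V, hV, hVsub⟩ := hmem
  rw [Pi.uniformity, Filter.mem_iInf] at hV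
  obtain ⟨I, hI, W, hW, rfl⟩ := hV
  have hδ : ∀ i : I, ∃ δ > 0, ∀ f g : X → ℝ, |f i - g i| < δ → (f, g) ∈ W i := by
    intro i
    obtain ⟨W', hW', hsub⟩ := Filter.mem_comap.1 (hW i)
    obtain ⟨δ, hδ, hd⟩ := Metric.mem_uniformity_dist.1 hW'
    exact ⟨δ, hδ, fun f g h => hsub (hd (by rwa [Real.dist_eq]))⟩
  choose δ hδ hd using hδ
  have := hI.to_subtype
  obtain ⟨ε, hε, hεδ⟩ : ∃ ε > 0, ∀ i, ε ≤ δ i := by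
    cases isEmpty_or_nonempty I
    · exact ⟨1, one_pos, fun i => isEmptyElim i⟩
    · obtain ⟨i, hi⟩ := Finite.exists_min δ
      exact ⟨δ i, hδ i, hi⟩
  obtain ⟨n, hn⟩ := exists_nat_one_div_lt hε
  refine ⟨hI.toFinset, n + 1, fun f g hfg => ?_⟩
  have hmemW : ((f : X → ℝ), (g : X → ℝ)) ∈ ⋂ i, W i := by
    refine Set.mem_iInter.2 fun i => hd i _ _ ?_
    have h1 := hfg i (hI.mem_toFinset.2 i.2)
    have h2 : 1 / (((n + 1 : ℕ) : ℝ) + 1) ≤ 1 / ((n : ℝ) + 1) := by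
      apply one_div_le_one_div_of_le (by positivity)
      push_cast
      linarith
    linarith [hεδ i]
  have h3 : dist ((T f : Y → ℝ) y) ((T g : Y → ℝ) y) < 1 :=
    hVsub (a := (f, g)) hmemW
  rw [Real.dist_eq] at h3
  push_cast
  linarith [(Nat.cast_nonneg n : (0 : ℝ) ≤ n)]

/-- `f + (g - f) φ`, for a continuous `φ` with values in `[0, 1]`. -/
theorem DSpace.exists_interpolation (f g : DSpace k X) {φ : X → ℝ} (hφ : Continuous φ)
    (hφ01 : ∀ x, φ x ∈ Set.Icc (0 : ℝ) 1) :
    ∃ h : DSpace k X, ∀ x, (h : X → ℝ) x =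
      (f : X → ℝ) x + ((g : X → ℝ) x - (f : X → ℝ) x) * φ x := by
  refine ⟨⟨fun x => (f : X → ℝ) x + ((g : X → ℝ) x - (f : X → ℝ) x) * φ x,
    f.2.1.add ((g.2.1.sub f.2.1).mul hφ), fun hk => ?_⟩, fun x => rfl⟩
  obtain ⟨M, hM⟩ := (g - f).2.2 hk
  obtain ⟨N, hN⟩ := f.2.2 hk
  refine ⟨N + M, fun x => (abs_add_le _ _).trans (add_le_add (hN x) ?_)⟩
  rw [abs_mul, abs_of_nonneg (hφ01 x).1]
  exact (mul_le_of_le_one_right (abs_nonneg _) (hφ01 x).2).trans (hM x)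

/-- If `x` cannot be removed from a set `K` determining `y`, then every set determining a
point near `y` meets a given neighbourhood of `x`. -/
theorem DeterminedBy.eventually_inter_nonempty [CompletelyRegularSpace X] [DecidableEq X]
    {p : ℕ} {y : Y} {K : Finset X} (hK : DeterminedBy T p y K) {x : X}
    (hmin : ¬ DeterminedBy T (2 * p) y (K.erase x)) {U : Set X} (hU : U ∈ 𝓝 x) :
    ∀ᶠ y' in 𝓝 y, ∀ K' : Finset X, DeterminedBy T p y' K' → ∃ z ∈ K', z ∈ U := by
  unfold DeterminedBy at hmin
  push Not at hmin
  obtain ⟨f, g, hfg, hlt⟩ := hmin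
  obtain ⟨φ, hφ, hφx, hφU⟩ : ∃ φ : X → ℝ, (Continuous φ ∧ ∀ z, φ z ∈ Set.Icc (0 : ℝ) 1) ∧
      φ x = 1 ∧ ∀ z ∉ U, φ z = 0 := by
    obtain ⟨ψ, hψ, hψx, hψU⟩ := CompletelyRegularSpace.completely_regular x (interior U)ᶜ
      isOpen_interior.isClosed_compl (by simpa [mem_interior_iff_mem_nhds] using hU)
    refine ⟨fun z => 1 - (ψ z : ℝ), ⟨by fun_prop, fun z => ?_⟩, by simp [hψx], fun z hz => ?_⟩
    · exact ⟨by linarith [(ψ z).2.2], by linarith [(ψ z).2.1]⟩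
    · simp [hψU (fun h => hz (interior_subset h) : z ∈ (interior U)ᶜ)]
  -- `h` agrees with `g` at `x` and with `f` off `U`. It is close to `g` on `K`, so of the gap `> 2
  -- * p` between `T f` and `T g` at `y`, more than `p` remains between `T f` and `T h`. This
  -- persists near `y`, which rules out a `K'` missing `U`.
  obtain ⟨h, hh⟩ := DSpace.exists_interpolation f g hφ.1 hφ.2
  have hhg : |(T h : Y → ℝ) y - (T g : Y → ℝ) y| ≤ p := by
    refine hK h g fun z hz => ?_
    have heq : (h : X → ℝ) z - (g : X → ℝ) z
        = ((f : X → ℝ) z - (g : X → ℝ) z) * (1 - φ z) := by rw [hh]; ring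
    rw [heq]
    by_cases hzx : z = x
    · rw [hzx, hφx]
      simp only [sub_self, mul_zero, abs_zero]
      positivity
    · have h1 := hfg z (Finset.mem_erase.2 ⟨hzx, hz⟩)
      have h2 : 1 / (((2 * p : ℕ) : ℝ) + 1) ≤ 1 / ((p : ℝ) + 1) := by
        apply one_div_le_one_div_of_le (by positivity)
        push_cast
        linarith [(Nat.cast_nonneg p : (0 : ℝ) ≤ p)]
      rw [abs_mul, abs_of_nonneg (by linarith [(hφ.2 z).2] : 0 ≤ 1 - φ z)]
      exact ((mul_le_of_le_one_right (abs_nonneg _) (by linarith [(hφ.2 z).1])).trans_lt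
        h1).trans_le h2
  have hfh : (p : ℝ) < |(T f : Y → ℝ) y - (T h : Y → ℝ) y| := by
    have := abs_sub_le ((T f : Y → ℝ) y) ((T h : Y → ℝ) y) ((T g : Y → ℝ) y)
    push_cast at hlt
    linarith
  have hcont : Continuous fun y' => |(T f : Y → ℝ) y' - (T h : Y → ℝ) y'| :=
    ((T f).2.1.sub (T h).2.1).abs
  filter_upwards [hcont.continuousAt.eventually_const_lt hfh] with y' hy' K' hK'
  by_contra hcon
  push Not at hcon
  refine absurd (hK' f h fun z hz => ?_) (not_le.2 hy')
  rw [hh, hφU z (hcon z hz)]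
  simp only [mul_zero, add_zero, sub_self, abs_zero]
  positivity

/-- In a completely regular Hausdorff space, points of a finite set can be separated from
another point by a function in `D(Y)` with values in `[0, c]`. -/
theorem DSpace.exists_bump [T35Space Y] {c : ℝ} (hc : 0 ≤ c) (s : Finset Y) {y : Y}
    (hy : y ∉ s) :
    ∃ g : DSpace l Y, (∀ z, |(g : Y → ℝ) z| ≤ c) ∧ (g : Y → ℝ) y = 0 ∧
      ∀ z ∈ s, (g : Y → ℝ) z = c := by
  obtain ⟨ψ, hψ, hψy, hψs⟩ := CompletelyRegularSpace.completely_regular y (s : Set Y)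
    s.finite_toSet.isClosed (by simpa using hy)
  have hb : ∀ z, |c * (ψ z : ℝ)| ≤ c := fun z => by
    rw [abs_of_nonneg (mul_nonneg hc (ψ z).2.1)]
    exact mul_le_of_le_one_right hc (ψ z).2.2
  refine ⟨⟨fun z => c * (ψ z : ℝ), by fun_prop, fun _ => ⟨c, hb⟩⟩, hb, by simp [hψy],
    fun z hz => ?_⟩
  have := hψs hz
  simp [this]

/-- Pigeonhole: the integer parts of `(p + 1) * f n` on `K` take only finitely many values. -/
theorem NormBoundedSeq.exists_close_pair {X : Type*} {f : ℕ → X → ℝ} (hf : NormBoundedSeq f)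
    (K : Finset X) (p : ℕ) :
    ∃ m n, m < n ∧ ∀ x ∈ K, |f m x - f n x| < 1 / ((p : ℝ) + 1) := by
  obtain ⟨M, -, hM⟩ := hf
  have hp : (0 : ℝ) < (p : ℝ) + 1 := by positivity
  let c : ℕ → K → Set.Icc ⌊((p : ℝ) + 1) * (-M)⌋ ⌊((p : ℝ) + 1) * M⌋ := fun n x =>
    ⟨⌊((p : ℝ) + 1) * f n x⌋,
      Int.floor_mono (mul_le_mul_of_nonneg_left (abs_le.1 (hM n x)).1 hp.le),
      Int.floor_mono (mul_le_mul_of_nonneg_left (abs_le.1 (hM n x)).2 hp.le)⟩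
  obtain ⟨m, n, hmn, hc⟩ := Finite.exists_ne_map_eq_of_infinite c
  have key : ∀ x ∈ K, |f m x - f n x| < 1 / ((p : ℝ) + 1) := by
    intro x hx
    have h1 : ⌊((p : ℝ) + 1) * f m x⌋ = ⌊((p : ℝ) + 1) * f n x⌋ :=
      congrArg Subtype.val (congrFun hc ⟨x, hx⟩)
    have h2 := Int.abs_sub_lt_one_of_floor_eq_floor h1
    rw [← mul_sub, abs_mul, abs_of_pos hp] at h2
    rwa [lt_div_iff₀ hp, mul_comm]
  rcases hmn.lt_or_gt with h | h
  · exact ⟨m, n, h, key⟩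
  · exact ⟨n, m, h, fun x hx => by rw [abs_sub_comm]; exact key x hx⟩

/-- Only finitely many points are determined by a given finite set with given constants. -/
theorem InverselyBounded.finite_setOf_determinedBy [T35Space Y] (hT : InverselyBounded T)
    (p : ℕ) (K : Finset X) : {y | DeterminedBy T p y K}.Finite := by
  classical
  by_contra hinf
  let y := Set.Infinite.natEmbedding _ hinf
  have hbump : ∀ n, ∃ g : DSpace l Y, (∀ z, |(g : Y → ℝ) z| ≤ (p : ℝ) + 1) ∧
      (g : Y → ℝ) (y n) = 0 ∧
      ∀ z ∈ (Finset.range n).image (fun i => (y i : Y)), (g : Y → ℝ) z = (p : ℝ) + 1 := by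
    intro n
    refine DSpace.exists_bump (by positivity) _ ?_
    simp only [Finset.mem_image, Finset.mem_range, not_exists, not_and]
    intro i hi h
    exact hi.ne (y.injective (Subtype.ext h))
  choose g hgb hg0 hg1 using hbump
  -- For `m < n`, `g m` and `g n` differ by `p + 1` at `y m`, too much for preimages close on `K`.
  obtain ⟨f, hf, hfg⟩ := hT g ⟨(p : ℝ) + 1, by positivity, hgb⟩
  obtain ⟨m, n, hmn, hclose⟩ := hf.exists_close_pair K p
  have h := (y m).2 (f m) (f n) hclose
  rw [hfg, hfg, hg0 m, hg1 n (y m) (Finset.mem_image_of_mem _ (Finset.mem_range.2 hmn)),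
    zero_sub, abs_neg, abs_of_pos (by positivity)] at h
  linarith

/-- Every point is determined by some finite set of minimal cardinality. -/
theorem UniformContinuous.exists_minimal_determinedBy (hT : UniformContinuous T) (y : Y) :
    ∃ (K : Finset X) (p : ℕ), DeterminedBy T p y K ∧
      ∀ (L : Finset X) (r : ℕ), DeterminedBy T r y L → K.card ≤ L.card := by
  classical
  have hex : ∃ q, ∃ (K : Finset X) (p : ℕ), DeterminedBy T p y K ∧ K.card = q := by
    obtain ⟨K, p, h⟩ := hT.exists_determinedBy y
    exact ⟨_, K, p, h, rfl⟩
  obtain ⟨K, p, h, hcard⟩ := Nat.find_spec hex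
  exact ⟨K, p, h, fun L r hL => hcard ▸ Nat.find_min' hex ⟨L, r, hL, rfl⟩⟩

end

/-! ### Decomposition of `Y` into discrete pieces -/

theorem theorem4p6 {X Y : Type*}
    [TopologicalSpace X] [TopologicalSpace.MetrizableSpace X]
    [TopologicalSpace Y] [TopologicalSpace.MetrizableSpace Y]
    (k l : FunKind) (T : DSpace k X → DSpace l Y)
    (hT_unif : UniformContinuous T) (hT_surj : Function.Surjective T)
    (hT_inv : InverselyBounded T)
    (hX : StronglySigmaScattered X) :
    StronglySigmaScattered Y := by
  classical
  let := TopologicalSpace.metrizableSpaceMetric X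
  let := TopologicalSpace.metrizableSpaceMetric Y
  obtain ⟨F, hF, hFcov⟩ := hX
  obtain ⟨E, hE, hEcov⟩ := exists_closedDiscrete_cover F (fun n => (hF n).2)
    (Set.iUnion_eq_univ_iff.1 hFcov)
  choose K p hK hmin using hT_unif.exists_minimal_determinedBy
  choose e he using hEcov
  let S : ℕ × ℕ × ℕ → Set Y := fun i =>
    {y | p y = i.1 ∧ (K y).card = i.2.1 ∧ ∀ x ∈ K y, e x ≤ i.2.2}
  refine stronglySigmaScattered_of_scattered_cover S ?_
    fun y => ⟨(p y, (K y).card, (K y).sup e), rfl, rfl, fun x hx => Finset.le_sup hx⟩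
  rintro ⟨r, q, n⟩
  refine isScatteredSet_of_eventually ?_
  rintro y ⟨rfl, rfl, hyn⟩
  -- The map `K` is locally constant on each piece.
  have hlocal : ∀ᶠ y' in 𝓝 y, ∀ x ∈ K y, ∀ K', DeterminedBy T (p y) y' K' →
      ∃ z ∈ K', z = x ∨ ∀ i ≤ n, z ∉ E i := by
    refine (Filter.eventually_all_finset (K y)).2 fun x hx => ?_
    refine (hK y).eventually_inter_nonempty (x := x) (fun h => ?_)
      (U := {z | z = x ∨ ∀ i ≤ n, z ∉ E i}) ?_
    -- Minimality ranges over all constants, hence also covers `2 * p y`.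
    · exact absurd (hmin y _ _ h) (not_le.2 (Finset.card_erase_lt_of_mem hx))
    · have h1 : ∀ᶠ z in 𝓝[≠] x, ∀ i ∈ Set.Iic n, z ∉ E i :=
        (Filter.eventually_all_finite (Set.finite_Iic n)).2 fun i _ => hE i x
      filter_upwards [eventually_nhdsWithin_iff.1 h1] with z hz
      exact or_iff_not_imp_left.2 hz
  have hfin : ∀ᶠ y' in 𝓝[≠] y, ¬ DeterminedBy T (p y) y' (K y) := by
    have h := hT_inv.finite_setOf_determinedBy (p y) (K y)
    have h' := (h.subset Set.sdiff_subset : ({y | DeterminedBy T _ y _} \ {y}).Finite)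
    filter_upwards [nhdsWithin_le_nhds (h'.isClosed.isOpen_compl.mem_nhds (by simp)),
      self_mem_nhdsWithin] with y' hy' hne hdet
    exact hy' ⟨hdet, hne⟩
  filter_upwards [hfin, hlocal.filter_mono nhdsWithin_le_nhds] with y' hy' hloc hS
  obtain ⟨hp, hcard, hn⟩ := hS
  have hdet : DeterminedBy T (p y) y' (K y') := by
    have h := hK y'
    rwa [show p y' = p y from hp] at h
  have hsub : K y ⊆ K y' := by
    intro x hx
    obtain ⟨z, hz, rfl | hzE⟩ := hloc x hx _ hdet
    · exact hz
    · exact absurd (he z) (hzE _ (hn z hz))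
  rw [← Finset.eq_of_subset_of_card_le hsub hcard.le] at hdet
  exact hy' hdet
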